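/- A gyrogroup is a set $G$ with a binary operation $\oplus$ such that: there is a unique identity element $0$ with $0\oplus a=a=a\oplus 0$ for all $a\in G$; each $x\in G$ has a unique inverse $\ominus x$ with $\ominus x\oplus x=0=x\oplus(\ominus x)$; for all $x,y\in G$ there is an automorphism $\mathrm{gyr}[x,y]$ of $(G,\oplus)$ with $x\oplus(y\oplus z)=(x\oplus y)\oplus \mathrm{gyr}[x,y](z)$ for all $z\in G$; and $\mathrm{gyr}[x\oplus y,y]=\mathrm{gyr}[x,y]$ for all $x,y\in G$. A topological gyrogroup is a gyrogroup with a topology for which $\oplus:G\times G\to G$ and $\ominus:G\to G$ are continuous. It is strongly topological if there is a neighborhood base $\mathscr U$ of $0$ such that $\mathrm{gyr}[x,y](U)=U$ for all $U\in\mathscr U$ and $x,y\in G$. It is feathered if it contains a non-empty compact set $K$ of countable character, i.e. there is a countable family $\mathcal B$ of open sets containing $K$ such that every open set containing $K$ contains a member of $\mathcal B$. A topological space $X$ is a $D$-space if for every assignment of an open set $N(x)\ni x$ to each $x\in X$ there is a closed discrete subset $D\subseteq X$ with $X=\bigcup_{x\in D}N(x)$. Theorem. Let $G$ be a feathered strongly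 topological gyrogroup whose topology is $T_1$. Then $G$ is a $D$-space. -/

import Mathlib

open Set Topology

/-- A gyrogroup, written additively (`x + y` is `x ⊕ y`, `-x` is `⊖x`; the operation is neither
commutative nor associative in general). The gyration `gyr x y` is an automorphism of the
groupoid `(G, +)`. The identity, the inverses and the gyrations are recorded as data; the lemmas
`Gyrogroup.zero_unique`, `Gyrogroup.neg_unique` and `Gyrogroup.gyr_unique` below show that each of
them is determined by the operation. -/
class Gyrogroup (G : Type*) extends Add G, Zero G, Neg G where
  gyr : G → G → (G ≃+ G)
  zero_add' : ∀ a : G, 0 + a = a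
  add_zero' : ∀ a : G, a + 0 = a
  neg_add' : ∀ a : G, -a + a = 0
  add_neg' : ∀ a : G, a + -a = 0
  /-- left gyroassociativity -/
  add_gyr : ∀ x y z : G, x + (y + z) = (x + y) + gyr x y z
  /-- left loop property -/
  gyr_loop : ∀ x y : G, gyr (x + y) y = gyr x y

namespace Gyrogroup

variable {G : Type*} [Gyrogroup G]

theorem zero_unique (e : G) (he : ∀ a : G, e + a = a ∧ a + e = a) : e = 0 := by
  rw [← (he 0).1, add_zero']

theorem add_left_cancel' (x y z : G) (h : x + y = x + z) : y = z := by
  have h' : -x + (x + y) = -x + (x + z) := by rw [h]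
  rw [add_gyr, add_gyr, neg_add', zero_add', zero_add'] at h'
  exact (gyr (-x) x).injective h'

theorem neg_unique (x y : G) (h : x + y = 0) : y = -x :=
  add_left_cancel' x _ _ (by rw [h, add_neg'])

theorem gyr_unique (x y : G) (f : G → G) (hf : ∀ z : G, x + (y + z) = (x + y) + f z) :
    f = gyr x y := by
  funext z
  exact add_left_cancel' (x + y) _ _ (by rw [← hf, add_gyr])

end Gyrogroup

/-- A topological gyrogroup: `⊕` is jointly continuous and `⊖` is continuous. -/
class TopologicalGyrogroup (G : Type*) [TopologicalSpace G] [Gyrogroup G] : Prop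
    extends ContinuousAdd G, ContinuousNeg G

/-- A strongly topological gyrogroup: a topological gyrogroup with a base `𝓤` of (not necessarily
open) neighbourhoods of `0`, each of which is mapped onto itself by every gyration. -/
class StronglyTopologicalGyrogroup (G : Type*) [TopologicalSpace G] [Gyrogroup G] : Prop
    extends TopologicalGyrogroup G where
  exists_invariant_basis : ∃ 𝓤 : Set (Set G), (𝓝 (0 : G)).HasBasis (fun U => U ∈ 𝓤) id ∧
    ∀ U ∈ 𝓤, ∀ x y : G, Gyrogroup.gyr x y '' U = U

/-- `B` is a base for `X` at the set `F`. -/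
def IsBaseAtSet {X : Type*} [TopologicalSpace X] (B : Set (Set X)) (F : Set X) : Prop :=
  (∀ U ∈ B, IsOpen U ∧ F ⊆ U) ∧ ∀ V : Set X, IsOpen V → F ⊆ V → ∃ U ∈ B, U ⊆ V

/-- A space is feathered if it contains a non-empty compact set of countable character. -/
def IsFeathered (X : Type*) [TopologicalSpace X] : Prop :=
  ∃ K : Set X, K.Nonempty ∧ IsCompact K ∧ ∃ B : Set (Set X), B.Countable ∧ IsBaseAtSet B K

/-- A space is a D-space if for every assignment of an open neighbourhood `N x` to each point `x`
there is a closed discrete subset `D` such that the sets `N x` with `x ∈ D` cover the space. -/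
def IsDSpace (X : Type*) [TopologicalSpace X] : Prop :=
  ∀ N : X → Set X, (∀ x, IsOpen (N x) ∧ x ∈ N x) →
    ∃ D : Set X, IsClosed D ∧ IsDiscrete D ∧ ⋃ x ∈ D, N x = univ

/-! Gyration-stable neighbourhoods `U n` of `0` make the sets `{y | -x + y ∈ U n}` symmetric with a
triangle inequality, as in a group. After translating the compact set to contain `0`, the `U n` can
be shrunk into a countable base at it; then the balls at each `x` form a base at a compact set
(`isCompact_iInter_and_base`). So `G` behaves like a pseudometric space with compact fibres. In such
a space (`isDSpace_of_uniform_balls`) finitely many `N f`, with `f` in the fibre of `x`, cover a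
ball of some index `n x`. Choosing centres greedily, least `n x` first, keeps them locally sparse,
and the finite sets attached to them form the required closed discrete set. -/

/-! ### D-spaces from uniform balls. -/

/-- Greedy selection along a well-founded relation. -/
theorem WellFounded.exists_greedy_set {α : Type*} {R : α → α → Prop} (hR : WellFounded R)
    (S : α → α → Prop) : ∃ D : Set α, ∀ x, x ∈ D ↔ ∀ d, R d x → d ∈ D → ¬ S d x := by
  refine ⟨{x | hR.fix (C := fun _ => Prop) (fun x ih => ∀ d (h : R d x), ih d h → ¬ S d x) x},
    fun x => ?_⟩
  rw [mem_ofPred_eq, hR.fix_eq]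
  rfl

/-- In a `T1` space, a set that is locally finite is closed and discrete. -/
theorem isClosed_and_isDiscrete_of_locally_finite {X : Type*} [TopologicalSpace X] [T1Space X]
    {D : Set X} (h : ∀ x, ∃ O ∈ 𝓝 x, (O ∩ D).Finite) : IsClosed D ∧ IsDiscrete D := by
  rw [isClosed_and_discrete_iff]
  intro x
  obtain ⟨O, hO, hfin⟩ := h x
  rw [Filter.disjoint_principal_right, mem_nhdsWithin_iff_eventually]
  have hc : ((O ∩ D) \ {x})ᶜ ∈ 𝓝 x :=
    (hfin.subset sdiff_subset).isClosed.isOpen_compl.mem_nhds fun hx => hx.2 rfl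
  filter_upwards [hO, hc] with y hyO hyc hyx hyD
  exact hyc ⟨⟨hyO, hyD⟩, hyx⟩

/-- A `T1` space with a countable family of uniform neighbourhoods `E n x`, such that at each point
these neighbourhoods form a base at a compact set, is a D-space. -/
theorem isDSpace_of_uniform_balls {X : Type*} [TopologicalSpace X] [T1Space X]
    (E : ℕ → X → Set X) (hE : ∀ n x, E n x ∈ 𝓝 x) (hanti : ∀ x, Antitone fun n => E n x)
    (hsymm : ∀ n x y, y ∈ E n x → x ∈ E n y)
    (htrans : ∀ n x y z, y ∈ E (n + 1) x → z ∈ E (n + 1) y → z ∈ E n x)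
    (hcpt : ∀ x, IsCompact (⋂ n, E n x))
    (hbase : ∀ x V, IsOpen V → ⋂ n, E n x ⊆ V → ∃ n, E n x ⊆ V) : IsDSpace X := by
  intro N hN
  have key : ∀ x, ∃ F : Finset X, ∃ n, (∀ f ∈ F, ∀ k, f ∈ E k x) ∧ E n x ⊆ ⋃ f ∈ F, N f := by
    intro x
    obtain ⟨F, hF, hFc⟩ := (hcpt x).elim_nhds_subcover N fun y _ => (hN y).1.mem_nhds (hN y).2
    obtain ⟨n, hn⟩ := hbase x _ (isOpen_biUnion fun f _ => (hN f).1) hFc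
    exact ⟨F, n, fun f hf k => mem_iInter.1 (hF f hf) k, hn⟩
  choose F n hF hn using key
  -- the interior of `E (n d) d` for the coarser uniform topology
  let S : X → X → Prop := fun d x => ∃ k, E k x ⊆ E (n d) d
  have hself : ∀ k x, x ∈ E k x := fun k x => mem_of_mem_nhds (hE k x)
  have hsub : ∀ k x y, y ∈ E (k + 1) x → E (k + 1) y ⊆ E k x :=
    fun k x y hy z hz => htrans k x y z hy hz
  have hSself : ∀ x, S x x := fun x => ⟨n x, subset_rfl⟩
  -- Larger balls come first; a well-order of the points breaks ties.
  let R : X → X → Prop := InvImage (Prod.Lex (· < ·) WellOrderingRel) fun x => (n x, x)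
  have hR : WellFounded R :=
    InvImage.wf _ (WellFounded.prod_lex wellFounded_lt WellOrderingRel.isWellOrder.wf)
  have hRn : ∀ x y, n x < n y → R x y := fun x y h => Prod.Lex.left _ _ h
  have hRtri : ∀ x y, x ≠ y → R x y ∨ R y x := by
    intro x y hxy
    rcases lt_trichotomy (n x) (n y) with h | h | h
    · exact Or.inl (hRn _ _ h)
    · rcases trichotomous_of WellOrderingRel x y with h' | h' | h'
      · exact Or.inl (Prod.lex_def.2 (Or.inr ⟨h, h'⟩))
      · exact absurd h' hxy
      · exact Or.inr (Prod.lex_def.2 (Or.inr ⟨h.symm, h'⟩))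
    · exact Or.inr (hRn _ _ h)
  obtain ⟨D, hD⟩ := hR.exists_greedy_set S
  have hcover : ∀ x, ∃ d ∈ D, S d x := by
    intro x
    by_cases hx : x ∈ D
    · exact ⟨x, hx, hSself x⟩
    · rw [hD] at hx
      push Not at hx
      obtain ⟨d, -, hd, hS⟩ := hx
      exact ⟨d, hd, hS⟩
  have hfin : ∀ x, ∃ O ∈ 𝓝 x, (O ∩ ⋃ d ∈ D, (F d : Set X)).Finite := by
    intro x
    obtain ⟨d, hd, k, hk⟩ := hcover x
    -- Beyond `k`, balls near `x` fit inside the ball of `d`; beyond `n d`, they fit inside the ball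
    -- of any centre `e` with `n e ≤ n d`. The added constants pay for the triangle inequalities.
    set m := max k (n d) with hm
    have hclose : ∀ e ∈ D, ∀ f ∈ F e, f ∈ E (m + 4) x → e ∈ E (m + 3) x :=
      fun e _ f hf hfx => htrans _ _ _ _ hfx (hsymm _ _ _ (hF e f hf _))
    -- A centre near `x` with a larger index comes after `d` and is already covered by it, so it was
    -- not selected.
    have hle : ∀ e ∈ D, e ∈ E (m + 3) x → n e ≤ n d := by
      intro e he hex
      by_contra! hlt
      refine (hD e).1 he d (hRn _ _ hlt) hd ⟨m + 3, fun z hz => hk ?_⟩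
      exact hanti x ((le_max_left _ _).trans (Nat.le_add_right m 2)) (hsub _ _ _ hex hz)
    -- Of two centres near `x`, the earlier covers the later. Hence at most one centre is near `x`,
    -- and only its finite set can meet a small ball.
    have hfar : ∀ e e', n e ≤ n d → R e e' → e ∈ D → e' ∈ D → e ∈ E (m + 3) x →
        e' ∈ E (m + 3) x → False := by
      intro e e' hn' hRe he he' hx hx'
      have h1 : e' ∈ E (m + 2) e := htrans _ _ _ _ (hsymm _ _ _ hx) hx'
      refine (hD e').1 he' e hRe he ⟨m + 2, fun z hz => ?_⟩
      exact hanti e ((hn'.trans (le_max_right k _)).trans (Nat.le_add_right m 1))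
        (hsub _ _ _ h1 hz)
    refine ⟨E (m + 4) x, hE _ _, ?_⟩
    by_cases hex : ∃ e ∈ D, e ∈ E (m + 3) x
    · obtain ⟨e, he, hex⟩ := hex
      refine (F e).finite_toSet.subset ?_
      rintro f ⟨hfx, hf⟩
      obtain ⟨e', he', hf⟩ := mem_iUnion₂.1 hf
      have hex' := hclose e' he' f hf hfx
      obtain rfl | hne := eq_or_ne e e'
      · exact hf
      · rcases hRtri e e' hne with h | h
        · exact (hfar e e' (hle e he hex) h he he' hex hex').elim
        · exact (hfar e' e (hle e' he' hex') h he' he hex' hex).elim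
    · refine finite_empty.subset ?_
      rintro f ⟨hfx, hf⟩
      obtain ⟨e, he, hf⟩ := mem_iUnion₂.1 hf
      exact hex ⟨e, he, hclose e he f hf hfx⟩
  obtain ⟨hcl, hdis⟩ := isClosed_and_isDiscrete_of_locally_finite hfin
  refine ⟨_, hcl, hdis, eq_univ_of_forall fun x => ?_⟩
  obtain ⟨d, hd, k, hk⟩ := hcover x
  obtain ⟨f, hf, hxf⟩ := mem_iUnion₂.1 (hn d (hk (hself k x)))
  exact mem_iUnion₂.2 ⟨f, mem_iUnion₂.2 ⟨d, hd, hf⟩, hxf⟩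

/-! ### Gyrogroup algebra and stable neighbourhoods. -/

namespace Gyrogroup

variable {G : Type*} [Gyrogroup G]

theorem gyr_zero_left (y z : G) : gyr 0 y z = z := by
  have h := add_gyr 0 y z
  rw [zero_add', zero_add'] at h
  exact (add_left_cancel' _ _ _ h).symm

theorem neg_add_cancel_left' (x y : G) : -x + (x + y) = y := by
  rw [add_gyr, neg_add', zero_add', ← gyr_loop, neg_add', gyr_zero_left]

theorem neg_neg' (x : G) : - -x = x :=
  (neg_unique (-x) x (neg_add' x)).symm

theorem add_neg_cancel_left' (x y : G) : x + (-x + y) = y := by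
  simpa only [neg_neg'] using neg_add_cancel_left' (-x) y

theorem neg_zero' : -(0 : G) = 0 :=
  (neg_unique 0 0 (zero_add' 0)).symm

theorem gyr_zero (x y : G) : gyr x y 0 = 0 := by
  apply add_left_cancel' (x + y)
  rw [← add_gyr, add_zero', add_zero']

theorem gyr_neg (x y z : G) : gyr x y (-z) = -gyr x y z :=
  neg_unique _ _ (by rw [← map_add, add_neg', gyr_zero])

/-- Source of the triangle inequality: a gyration-stable set absorbs the gyration. -/
theorem neg_add_eq_add_gyr (x y z : G) :
    -x + z = (-x + y) + gyr (-x) y (-y + z) := by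
  rw [← add_gyr, add_neg_cancel_left']

/-- Source of the symmetry of the balls. -/
theorem neg_neg_add_eq_gyr (x y : G) : -(-x + y) = gyr (-x) y (-y + x) := by
  refine (neg_unique _ _ ?_).symm
  rw [← neg_add_eq_add_gyr, neg_add']

variable [TopologicalSpace G]

/-- Left translation as a homeomorphism. -/
def addLeftHomeomorph [ContinuousAdd G] (x : G) : G ≃ₜ G where
  toFun y := x + y
  invFun y := -x + y
  left_inv := neg_add_cancel_left' x
  right_inv := add_neg_cancel_left' x
  continuous_toFun := continuous_const_add x
  continuous_invFun := continuous_const_add (-x)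

/-- A neighbourhood of `0` contains a symmetric gyration-stable neighbourhood `V` with
`V + V` still inside. -/
theorem exists_stable_nhds [StronglyTopologicalGyrogroup G] {U : Set G} (hU : U ∈ 𝓝 (0 : G)) :
    ∃ V ∈ 𝓝 (0 : G), (∀ x y, ∀ v ∈ V, gyr x y v ∈ V) ∧ (∀ v ∈ V, -v ∈ V) ∧
      ∀ v ∈ V, ∀ w ∈ V, v + w ∈ U := by
  have hadd : Filter.Tendsto (fun p : G × G => p.1 + p.2) (𝓝 0 ×ˢ 𝓝 0) (𝓝 0) := by
    have h := (continuous_add (M := G)).tendsto (0, 0)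
    rwa [nhds_prod_eq, zero_add'] at h
  obtain ⟨W, hW, hWU⟩ := Filter.mem_prod_same_iff.1 (hadd hU)
  obtain ⟨𝓤, hb, hinv⟩ := StronglyTopologicalGyrogroup.exists_invariant_basis (G := G)
  obtain ⟨V, hV, hVW⟩ := hb.mem_iff.1 hW
  have hst : ∀ x y, ∀ v ∈ V, gyr x y v ∈ V := fun x y v hv => by
    have := mem_image_of_mem (gyr x y) hv
    rwa [hinv V hV] at this
  have hneg : Filter.Tendsto (fun x : G => -x) (𝓝 0) (𝓝 0) := by
    have h := (continuous_neg (G := G)).tendsto 0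
    rwa [neg_zero'] at h
  refine ⟨V ∩ {v | -v ∈ V}, Filter.inter_mem (hb.mem_of_mem hV) (hneg (hb.mem_of_mem hV)), ?_, ?_,
    fun v hv w hw => hWU (mk_mem_prod (hVW hv.1) (hVW hw.1))⟩
  · rintro x y v ⟨h1, h2⟩
    refine ⟨hst x y v h1, ?_⟩
    rw [mem_ofPred_eq, ← gyr_neg]
    exact hst x y _ h2
  · rintro v ⟨h1, h2⟩
    exact ⟨h2, by rwa [mem_ofPred_eq, neg_neg']⟩

/-- Inside any sequence of neighbourhoods of `0` there is a sequence of symmetric gyration-stable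
neighbourhoods of `0`, each containing the sum of the next one with itself. -/
theorem exists_stable_seq [StronglyTopologicalGyrogroup G] {B : ℕ → Set G}
    (hB : ∀ n, B n ∈ 𝓝 (0 : G)) :
    ∃ U : ℕ → Set G, (∀ n, U n ∈ 𝓝 (0 : G)) ∧ (∀ n, U n ⊆ B n) ∧
      (∀ n x y, ∀ v ∈ U n, gyr x y v ∈ U n) ∧ (∀ n, ∀ v ∈ U n, -v ∈ U n) ∧
      ∀ n, ∀ v ∈ U (n + 1), ∀ w ∈ U (n + 1), v + w ∈ U n := by
  choose V hV hst hneg hadd using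
    fun U : {U : Set G // U ∈ 𝓝 (0 : G)} => exists_stable_nhds U.2
  let U : ℕ → {U : Set G // U ∈ 𝓝 (0 : G)} := fun n =>
    Nat.rec ⟨V ⟨B 0, hB 0⟩, hV _⟩ (fun n U => ⟨V ⟨U.1 ∩ B (n + 1),
      Filter.inter_mem U.2 (hB _)⟩, hV _⟩) n
  have hVU : ∀ U, V U ⊆ U.1 := fun U v hv => by
    simpa only [add_zero'] using hadd U v hv 0 (mem_of_mem_nhds (hV U))
  refine ⟨fun n => (U n).1, fun n => (U n).2, ?_, ?_, ?_, ?_⟩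
  · rintro (_ | n)
    · exact hVU _
    · exact (hVU _).trans inter_subset_right
  · rintro (_ | n)
    · exact hst _
    · exact hst _
  · rintro (_ | n)
    · exact hneg _
    · exact hneg _
  · exact fun n v hv w hw => (hadd _ v hv w hw).1

end Gyrogroup

/-! ### Bases at compact sets. -/

/-- A sequence of sets with nested closures, each contained in the corresponding member of a
decreasing base at a compact set, is a base at its (compact) intersection. -/
theorem isCompact_iInter_and_base {X : Type*} [TopologicalSpace X] [T1Space X] {K : Set X}
    (hK : IsCompact K) {B U : ℕ → Set X} (hBK : (nhdsSet K).HasAntitoneBasis B)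
    (hUB : ∀ n, U n ⊆ B n) (hcl : ∀ n, closure (U (n + 1)) ⊆ U n) :
    IsCompact (⋂ n, U n) ∧ ∀ V, IsOpen V → ⋂ n, U n ⊆ V → ∃ n, U n ⊆ V := by
  have hanti : Antitone U := antitone_nat_of_succ_le fun n => subset_closure.trans (hcl n)
  have heq : ⋂ n, U n = ⋂ n, closure (U n) :=
    Subset.antisymm (iInter_mono fun n => subset_closure)
      (subset_iInter fun n => (iInter_subset _ (n + 1)).trans (hcl n))
  have hsub : ⋂ n, U n ⊆ K := by
    intro x hx
    by_contra hxK
    have hmem : ({x}ᶜ : Set X) ∈ nhdsSet K :=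
      isOpen_compl_singleton.mem_nhdsSet.2 fun y hy hyx => hxK (hyx ▸ hy)
    obtain ⟨n, hn⟩ := hBK.mem_iff.1 hmem
    exact hn (hUB n (mem_iInter.1 hx n)) rfl
  refine ⟨hK.of_isClosed_subset (heq ▸ isClosed_iInter fun n => isClosed_closure) hsub, ?_⟩
  intro V hV hUV
  by_contra! hne
  have hdir : (⨅ n, Filter.principal (U n \ V)).HasBasis (fun _ : ℕ => True) fun n => U n \ V :=
    Filter.hasBasis_iInf_principal
      (Antitone.directed_ge fun i j h => sdiff_subset_sdiff_left (hanti h))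
  have hbot : (⨅ n, Filter.principal (U n \ V)).NeBot :=
    hdir.neBot_iff.2 fun {n} _ => sdiff_nonempty.2 (hne n)
  -- An ultrafilter containing every `U n \ V` is finer than `nhdsSet K`, so by compactness it
  -- converges to a point of `K`. That point lies in every `closure (U n)`, hence in `V`, a
  -- contradiction.
  set L := Ultrafilter.of (⨅ n, Filter.principal (U n \ V))
  have hL : ∀ n, U n \ V ∈ L := fun n => Ultrafilter.of_le _ (hdir.mem_of_mem trivial)
  have hLK : (L : Filter X) ≤ nhdsSet K := fun s hs => by
    obtain ⟨n, hn⟩ := hBK.mem_iff.1 hs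
    exact Filter.mem_of_superset (hL n) ((sdiff_subset.trans (hUB n)).trans hn)
  obtain ⟨x, hxK, hx⟩ : ∃ x ∈ K, (L : Filter X) ≤ 𝓝 x := by
    by_contra! hno
    have : ∀ x ∈ K, ∃ s ∈ 𝓝 x, s ∉ L := fun x hx => Filter.not_le.1 (hno x hx)
    choose! s hs hsL using this
    obtain ⟨t, ht, hKt⟩ := hK.elim_nhds_subcover (fun x => interior (s x))
      fun x hx => interior_mem_nhds.2 (hs x hx)
    have hmem : (⋃ x ∈ t, interior (s x)) ∈ L :=
      hLK ((isOpen_biUnion fun _ _ => isOpen_interior).mem_nhdsSet.2 hKt)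
    obtain ⟨y, hy, hyL⟩ := (Ultrafilter.finite_biUnion_mem_iff t.finite_toSet).1 hmem
    exact hsL y (ht y hy) (Filter.mem_of_superset hyL interior_subset)
  have hxU : x ∈ ⋂ n, U n := heq ▸ mem_iInter.2 fun n => mem_closure_iff_ultrafilter.2
    ⟨L, Filter.mem_of_superset (hL n) sdiff_subset, hx⟩
  have hVL : V ∈ L := hx (hV.mem_nhds (hUV hxU))
  obtain ⟨y, hy, hyV⟩ := L.nonempty_of_mem (Filter.inter_mem hVL (hL 0))
  exact hyV.2 hy

/-- Countable character of a set gives a countably generated neighbourhood filter. -/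
theorem IsBaseAtSet.hasBasis_nhdsSet {X : Type*} [TopologicalSpace X] {B : Set (Set X)} {K : Set X}
    (hB : IsBaseAtSet B K) : (nhdsSet K).HasBasis (fun U => U ∈ B) id := by
  refine ⟨fun t => ⟨fun ht => ?_, ?_⟩⟩
  · obtain ⟨V, hV, hKV, hVt⟩ := mem_nhdsSet_iff_exists.1 ht
    obtain ⟨U, hU, hUV⟩ := hB.2 V hV hKV
    exact ⟨U, hU, hUV.trans hVt⟩
  · rintro ⟨U, hU, hUt⟩
    exact Filter.mem_of_superset ((hB.1 U hU).1.mem_nhdsSet.2 (hB.1 U hU).2) hUt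

theorem Homeomorph.map_nhdsSet {X Y : Type*} [TopologicalSpace X] [TopologicalSpace Y]
    (f : X ≃ₜ Y) (K : Set X) : Filter.map f (nhdsSet K) = nhdsSet (f '' K) := by
  simp only [nhdsSet, sSup_image, Filter.map_iSup, iSup_image, f.map_nhds_eq]

/-! ### Feathered strongly topological gyrogroups. -/

theorem mainTheorem3 (G : Type*) [TopologicalSpace G] [T1Space G] [Gyrogroup G]
    [StronglyTopologicalGyrogroup G] (hG : IsFeathered G) : IsDSpace G := by
  open Gyrogroup in
  obtain ⟨K₀, ⟨k, hk⟩, hK₀, B₀, hcount, hB₀⟩ := hG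
  -- Once the compact set contains `0`, its neighbourhoods are neighbourhoods of `0`.
  have hK : IsCompact (addLeftHomeomorph (-k) '' K₀) :=
    hK₀.image (addLeftHomeomorph (-k)).continuous
  have h0 : (0 : G) ∈ addLeftHomeomorph (-k) '' K₀ := ⟨k, hk, neg_add' k⟩
  have : (nhdsSet K₀).IsCountablyGenerated :=
    Filter.HasCountableBasis.isCountablyGenerated ⟨hB₀.hasBasis_nhdsSet, hcount⟩
  have : (nhdsSet (addLeftHomeomorph (-k) '' K₀)).IsCountablyGenerated := by
    rw [← Homeomorph.map_nhdsSet]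
    infer_instance
  generalize addLeftHomeomorph (-k) '' K₀ = K at hK h0 this
  obtain ⟨B, hB⟩ := (nhdsSet K).exists_antitone_basis
  obtain ⟨U, hU, hUB, hst, hneg, hadd⟩ :=
    exists_stable_seq fun n => nhds_le_nhdsSet h0 (hB.1.mem_of_mem trivial)
  have hsymm : ∀ n (x y : G), -x + y ∈ U n → -y + x ∈ U n := by
    intro n x y h
    have h1 := hst n (-y) x _ h
    rw [← neg_neg_add_eq_gyr] at h1
    simpa only [neg_neg'] using hneg n _ h1
  have htrans : ∀ n (x y z : G), -x + y ∈ U (n + 1) → -y + z ∈ U (n + 1) → -x + z ∈ U n := by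
    intro n x y z h1 h2
    rw [neg_add_eq_add_gyr x y z]
    exact hadd n _ h1 _ (hst _ _ _ _ h2)
  have hsucc : ∀ n, U (n + 1) ⊆ U n := fun n v hv => by
    simpa only [add_zero'] using hadd n v hv 0 (mem_of_mem_nhds (hU _))
  have hnhds : ∀ n (x : G), {y | -x + y ∈ U n} ∈ 𝓝 x := fun n x =>
    (continuous_const_add (-x)).continuousAt.preimage_mem_nhds (by rw [Gyrogroup.neg_add']; exact hU n)
  have hcl : ∀ n, closure (U (n + 1)) ⊆ U n := by
    intro n x hx
    -- The ball around `x` meets `U (n + 1)` at `v`; go from `0` to `x` through `v`.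
    obtain ⟨v, hxv, hv⟩ := mem_closure_iff_nhds.1 hx _ (hnhds (n + 1) x)
    have h := htrans n 0 v x (by rwa [neg_zero', zero_add']) (hsymm _ _ _ hxv)
    rwa [neg_zero', zero_add'] at h
  obtain ⟨hcpt, hbase⟩ := isCompact_iInter_and_base hK hB hUB hcl
  have hpre : ∀ x : G, ⋂ n, {y | -x + y ∈ U n} = addLeftHomeomorph x '' ⋂ n, U n := by
    intro x
    rw [← Homeomorph.preimage_symm, preimage_iInter]
    rfl
  refine isDSpace_of_uniform_balls (fun n x => {y | -x + y ∈ U n}) hnhds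
    (fun x => antitone_nat_of_succ_le fun n y hy => hsucc n hy) hsymm htrans ?_ ?_
  · intro x
    rw [hpre]
    exact hcpt.image (addLeftHomeomorph x).continuous
  · intro x V hV hsub
    rw [hpre, image_subset_iff] at hsub
    obtain ⟨n, hn⟩ := hbase _ (hV.preimage (addLeftHomeomorph x).continuous) hsub
    refine ⟨n, fun y hy => ?_⟩
    have h : x + (-x + y) ∈ V := hn hy
    rwa [add_neg_cancel_left'] at h
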